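/- Let $1\le p\le\infty$. Let $F_p$ be the space of absolutely continuous functions $f:[0,1]\to\mathbb C$ with $f'\in L_p([0,1])$, and for $d\in\mathbb N=\{1,2,\dots\}$ let $F_{d,p}=\bigotimes_{j=1}^d F_p$ be the algebraic tensor product, regarded as a space of functions on $[0,1]^d$. For $u\subset[d]=\{1,\dots,d\}$ write $f^{(u)}=\prod_{j\in u}\frac{\partial}{\partial x_j}f$, and write $(x_u;t)$ for the point $y$ with $y_j=x_j$ for $j\in u$ and $y_j=t_j$ for $j\notin u$. With the weights $\gamma_u=\gamma_{d,u}=d^{-|u|}$, consider on $F_{d,p}$ the anchored norm and the ANOVA norm $$\|f\|_{\pitchfork,d,p}=\Bigl(\sum_{u\subset[d]}\gamma_u^{-p}\int_{[0,1]^u}|f^{(u)}(x_u;0)|^p\,dx_u\Bigr)^{1/p},$$ $$\|f\|_{A,d,p}=\Bigl(\sum_{u\subset[d]}\gamma_u^{-p}\int_{[0,1]^u}\Bigl|\int_{[0,1]^{[d]\setminus u}}f^{(u)}(x_u;t)\,dt\Bigr|^p dx_u\Bigr)^{1/p}$$ (for $p=\infty$: the maximum over $u$ of $\gamma_u^{-1}$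 times the $L_\infty([0,1]^u)$-norms of the same functions), and let $F_{\pitchfork,d,p}$ and $F_{A,d,p}$ be the completions of $F_{d,p}$ in these norms. Then $F_{\pitchfork,d,p}$ and $F_{A,d,p}$ are uniformly equivalent in $d$: there is a constant $c>0$, not depending on $d$, such that for every $d\ge 1$ the identity of $F_{d,p}$ extends to an isomorphism $J_d:F_{\pitchfork,d,p}\to F_{A,d,p}$ of Banach spaces with $\|J_d\|\le c$ and $\|J_d^{-1}\|\le c$. -/

import Mathlib

open MeasureTheory Set
open scoped ENNReal

noncomputable section

namespace MixedSmoothness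

/-! ### The univariate space and its algebraic tensor powers -/

/-- The extension of a function on `[0,1]` to the real line, constant to the left of `0` and to the
right of `1`. It only serves to apply notions that are stated for functions on `ℝ`. -/
def extendReal (f : unitInterval → ℂ) : ℝ → ℂ := Set.IccExtend (zero_le_one : (0 : ℝ) ≤ 1) f

/-- The derivative of a function on `[0,1]` (one-sided at the end points). -/
def deriv01 (f : unitInterval → ℂ) (x : unitInterval) : ℂ := derivWithin (extendReal f) (Icc 0 1) x

/-- Membership in the univariate space `F_p`: `f : [0,1] → ℂ` is absolutely continuous and its
first derivative, which exists almost everywhere, belongs to `L_p([0,1])`. -/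
structure IsUnivariate (p : ℝ≥0∞) (f : unitInterval → ℂ) : Prop where
  absCont : AbsolutelyContinuousOnInterval (extendReal f) 0 1
  memLp_deriv : MemLp (deriv01 f) p volume

/-- The elementary tensor `h_1 ⊗ ⋯ ⊗ h_d`, as a function on the cube. -/
def tensor {d : ℕ} (h : Fin d → unitInterval → ℂ) : (Fin d → unitInterval) → ℂ :=
  fun x => ∏ j, h j (x j)

/-- The algebraic tensor product `F_p ⊗ ⋯ ⊗ F_p` (`d` factors) of functions on `[0,1]^d`: the linear
span of the elementary tensors. -/
def TensorSpace (d : ℕ) (p : ℝ≥0∞) : Submodule ℂ ((Fin d → unitInterval) → ℂ) :=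
  Submodule.span ℂ {f | ∃ h : Fin d → unitInterval → ℂ, (∀ j, IsUnivariate p (h j)) ∧ f = tensor h}

/-! ### Mixed derivatives, anchored and ANOVA components -/

/-- The partial derivative `∂f/∂x_j` of a function on the cube. -/
def pderiv {d : ℕ} (j : Fin d) (f : (Fin d → unitInterval) → ℂ) : (Fin d → unitInterval) → ℂ :=
  fun x => deriv01 (fun s => f (Function.update x j s)) (x j)

/-- Successive partial derivatives with respect to the coordinates in a list. -/
def iterDeriv {d : ℕ} (l : List (Fin d)) (f : (Fin d → unitInterval) → ℂ) :
    (Fin d → unitInterval) → ℂ :=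
  l.foldr pderiv f

/-- The mixed derivative `f^{(u)} = ∏_{j ∈ u} ∂/∂x_j f`. -/
def mixedDeriv {d : ℕ} (u : Finset (Fin d)) (f : (Fin d → unitInterval) → ℂ) :
    (Fin d → unitInterval) → ℂ :=
  iterDeriv u.sort f

/-- The point `(x_u; t_{u^c})` of the cube. -/
def glue {d : ℕ} (u : Finset (Fin d)) (x : {j // j ∈ u} → unitInterval)
    (t : {j // j ∉ u} → unitInterval) : Fin d → unitInterval :=
  fun j => if h : j ∈ u then x ⟨j, h⟩ else t ⟨j, h⟩

/-- The function `f^{(u)}(·_u; 0)` on `[0,1]^u`. -/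
def anchoredPart {d : ℕ} (u : Finset (Fin d)) (f : (Fin d → unitInterval) → ℂ) :
    ({j // j ∈ u} → unitInterval) → ℂ :=
  fun x => mixedDeriv u f (glue u x 0)

/-- The function `∫_{[0,1]^{[d] ∖ u}} f^{(u)}(·_u; t) dt` on `[0,1]^u`. -/
def anovaPart {d : ℕ} (u : Finset (Fin d)) (f : (Fin d → unitInterval) → ℂ) :
    ({j // j ∈ u} → unitInterval) → ℂ :=
  fun x => ∫ t : {j // j ∉ u} → unitInterval, mixedDeriv u f (glue u x t)

/-! ### Linearity and integrability facts needed for the norms -/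

/-- `f` has all the iterated partial derivatives, at points with the relevant coordinates in `D`. -/
def Reg {d : ℕ} (D : Set unitInterval) (f : (Fin d → unitInterval) → ℂ) : Prop :=
  ∀ l : List (Fin d), l.Nodup → ∀ j ∉ l, ∀ x : Fin d → unitInterval, (∀ i ∈ l, x i ∈ D) → x j ∈ D →
    DifferentiableWithinAt ℝ (extendReal fun s => iterDeriv l f (Function.update x j s)) (Icc 0 1) (x j)

theorem Reg.mono {d : ℕ} {D E : Set unitInterval} {f : (Fin d → unitInterval) → ℂ}
    (hf : Reg E f) (h : D ⊆ E) : Reg D f :=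
  fun l hl j hj x hx hxj => hf l hl j hj x (fun i hi => h (hx i hi)) (h hxj)

theorem update_mem {d : ℕ} {D : Set unitInterval} {l : List (Fin d)} {j : Fin d} (hj : j ∉ l)
    {x : Fin d → unitInterval} (hx : ∀ i ∈ l, x i ∈ D) (s : unitInterval) :
    ∀ i ∈ l, Function.update x j s i ∈ D := by
  intro i hi
  have hij : i ≠ j := by
    rintro rfl
    exact hj hi
  rw [Function.update_of_ne hij]
  exact hx i hi

theorem iterDeriv_add {d : ℕ} {D : Set unitInterval} {f g : (Fin d → unitInterval) → ℂ}
    (hf : Reg D f) (hg : Reg D g) : ∀ l : List (Fin d), l.Nodup → ∀ x : Fin d → unitInterval,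
      (∀ i ∈ l, x i ∈ D) → iterDeriv l (f + g) x = iterDeriv l f x + iterDeriv l g x := by
  intro l
  induction l with
  | nil => intro _ x _; rfl
  | cons j l ih =>
    intro hl x hx
    obtain ⟨hj, hl'⟩ := List.nodup_cons.1 hl
    have hx' : ∀ i ∈ l, x i ∈ D := fun i hi => hx i (List.mem_cons_of_mem _ hi)
    have hxj : x j ∈ D := hx j List.mem_cons_self
    have e : (fun s => iterDeriv l (f + g) (Function.update x j s)) =
        fun s => iterDeriv l f (Function.update x j s) + iterDeriv l g (Function.update x j s) := by
      funext s
      exact ih hl' _ (update_mem hj hx' s)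
    change derivWithin (extendReal fun s => iterDeriv l (f + g) (Function.update x j s)) (Icc 0 1) (x j) =
      derivWithin (extendReal fun s => iterDeriv l f (Function.update x j s)) (Icc 0 1) (x j) +
      derivWithin (extendReal fun s => iterDeriv l g (Function.update x j s)) (Icc 0 1) (x j)
    rw [e]
    exact derivWithin_fun_add (hf l hl' j hj x hx' hxj) (hg l hl' j hj x hx' hxj)

theorem iterDeriv_smul {d : ℕ} (c : ℂ) (f : (Fin d → unitInterval) → ℂ) (l : List (Fin d)) :
    iterDeriv l (c • f) = c • iterDeriv l f := by
  induction l with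
  | nil => rfl
  | cons j l ih =>
    funext x
    change derivWithin (extendReal fun s => iterDeriv l (c • f) (Function.update x j s)) (Icc 0 1) (x j) =
      c • derivWithin (extendReal fun s => iterDeriv l f (Function.update x j s)) (Icc 0 1) (x j)
    rw [ih]
    exact derivWithin_fun_const_smul_field c _

theorem Reg.add {d : ℕ} {D : Set unitInterval} {f g : (Fin d → unitInterval) → ℂ}
    (hf : Reg D f) (hg : Reg D g) : Reg D (f + g) := by
  intro l hl j hj x hx hxj
  have e : (fun s => iterDeriv l (f + g) (Function.update x j s)) =
      fun s => iterDeriv l f (Function.update x j s) + iterDeriv l g (Function.update x j s) := by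
    funext s
    exact iterDeriv_add hf hg l hl _ (update_mem hj hx s)
  rw [e]
  exact (hf l hl j hj x hx hxj).add (hg l hl j hj x hx hxj)

theorem Reg.smul {d : ℕ} {D : Set unitInterval} (c : ℂ) {f : (Fin d → unitInterval) → ℂ}
    (hf : Reg D f) : Reg D (c • f) := by
  intro l hl j hj x hx hxj
  rw [iterDeriv_smul]
  exact (hf l hl j hj x hx hxj).const_smul c

theorem iterDeriv_tensor {d : ℕ} (h : Fin d → unitInterval → ℂ) :
    ∀ l : List (Fin d), l.Nodup → ∀ x : Fin d → unitInterval,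
      iterDeriv l (tensor h) x = ∏ j, if j ∈ l then deriv01 (h j) (x j) else h j (x j) := by
  intro l
  induction l with
  | nil => intro _ x; simp [iterDeriv, tensor]
  | cons j l ih =>
    intro hl x
    obtain ⟨hj, hl'⟩ := List.nodup_cons.1 hl
    have e : (fun s => iterDeriv l (tensor h) (Function.update x j s)) = fun s =>
        (∏ i ∈ Finset.univ.erase j, if i ∈ l then deriv01 (h i) (x i) else h i (x i)) • h j s := by
      funext s
      rw [ih hl', ← Finset.mul_prod_erase _ _ (Finset.mem_univ j), mul_comm, smul_eq_mul]
      simp only [hj, if_false, Function.update_self]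
      congr 1
      refine Finset.prod_congr rfl fun i hi => ?_
      rw [Function.update_of_ne (Finset.ne_of_mem_erase hi)]
    change derivWithin (extendReal fun s => iterDeriv l (tensor h) (Function.update x j s))
      (Icc 0 1) (x j) = _
    rw [e, ← Finset.mul_prod_erase _ _ (Finset.mem_univ j)]
    refine (derivWithin_fun_const_smul_field _ (extendReal (h j))).trans ?_
    rw [smul_eq_mul, mul_comm, if_pos List.mem_cons_self]
    congr 1
    refine Finset.prod_congr rfl fun i hi => ?_
    simp [Finset.ne_of_mem_erase hi]

theorem Reg.tensor {d : ℕ} {D : Set unitInterval} {h : Fin d → unitInterval → ℂ}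
    (hD : ∀ j, ∀ x ∈ D, DifferentiableWithinAt ℝ (extendReal (h j)) (Icc 0 1) x) : Reg D (tensor h) := by
  intro l hl j hj x hx hxj
  have e : (fun s => iterDeriv l (MixedSmoothness.tensor h) (Function.update x j s)) = fun s =>
      (∏ i ∈ Finset.univ.erase j, if i ∈ l then deriv01 (h i) (x i) else h i (x i)) • h j s := by
    funext s
    rw [iterDeriv_tensor h l hl, ← Finset.mul_prod_erase _ _ (Finset.mem_univ j), mul_comm,
      smul_eq_mul]
    simp only [hj, if_false, Function.update_self]
    congr 1
    refine Finset.prod_congr rfl fun i hi => ?_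
    rw [Function.update_of_ne (Finset.ne_of_mem_erase hi)]
  rw [e]
  exact (hD j (x j) hxj).const_smul
    (∏ i ∈ Finset.univ.erase j, if i ∈ l then deriv01 (h i) (x i) else h i (x i))

theorem IsUnivariate.ae_differentiable {p : ℝ≥0∞} {f : unitInterval → ℂ} (hf : IsUnivariate p f) :
    ∀ᵐ x : unitInterval, DifferentiableWithinAt ℝ (extendReal f) (Icc 0 1) x := by
  have h := hf.absCont.boundedVariationOn.ae_differentiableAt_of_mem_uIcc
  have h' : ∀ᵐ x ∂(volume.restrict (Icc (0 : ℝ) 1)),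
      DifferentiableWithinAt ℝ (extendReal f) (Icc 0 1) x := by
    rw [ae_restrict_iff' measurableSet_Icc]
    filter_upwards [h] with x hx hx'
    exact (hx (by rwa [uIcc_of_le zero_le_one])).differentiableWithinAt
  exact unitInterval.measurePreserving_coe.quasiMeasurePreserving.ae h'

theorem IsUnivariate.continuous {p : ℝ≥0∞} {f : unitInterval → ℂ} (hf : IsUnivariate p f) :
    Continuous f := by
  have h := hf.absCont.uniformContinuousOn.continuousOn
  rw [uIcc_of_le zero_le_one] at h
  have h2 := h.domRestrict
  convert h2 using 1
  funext x
  simp [extendReal]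

theorem memLp_tensor {ι : Type*} [Fintype ι] {p : ℝ≥0∞} {g : ι → unitInterval → ℂ}
    (hg : ∀ i, MemLp (g i) p volume) :
    MemLp (fun x : ι → unitInterval => ∏ i, g i (x i)) p volume := by
  have hev : ∀ i, Measure.QuasiMeasurePreserving (fun x : ι → unitInterval => x i)
      volume volume := fun i => Measure.quasiMeasurePreserving_eval _ i
  have hm : AEStronglyMeasurable (fun x : ι → unitInterval => ∏ i, g i (x i)) volume :=
    Finset.univ.aestronglyMeasurable_fun_prod fun i _ =>
      (hg i).1.comp_quasiMeasurePreserving (hev i)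
  rcases eq_or_ne p 0 with rfl | h0
  · exact memLp_zero_iff_aestronglyMeasurable.2 hm
  rcases eq_or_ne p ∞ with rfl | htop
  · have hb : ∀ i, ∃ C : ℝ, ∀ᵐ s, ‖g i s‖ ≤ C := by
      intro i
      have ht : eLpNormEssSup (g i) volume ≠ ∞ := by
        rw [← eLpNorm_exponent_top]
        exact (hg i).2.ne
      refine ⟨(eLpNormEssSup (g i) volume).toReal, ?_⟩
      filter_upwards [ae_le_eLpNormEssSup (f := g i) (μ := volume)] with s hs
      rw [← toReal_enorm]
      exact ENNReal.toReal_mono ht hs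
    choose C hC using hb
    refine memLp_top_of_bound hm (∏ i, C i) ?_
    have : ∀ᵐ x : ι → unitInterval, ∀ i, ‖g i (x i)‖ ≤ C i :=
      ae_all_iff.2 fun i => (hev i).ae (hC i)
    filter_upwards [this] with x hx
    rw [norm_prod]
    exact Finset.prod_le_prod (fun i _ => norm_nonneg _) fun i _ => hx i
  · rw [← integrable_norm_rpow_iff hm h0 htop]
    have : ∀ i, Integrable (fun s => ‖g i s‖ ^ p.toReal) volume := fun i =>
      (integrable_norm_rpow_iff (hg i).1 h0 htop).2 (hg i)
    refine (Integrable.fintype_prod this).congr (ae_of_all _ fun x => ?_)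
    simp only [norm_prod]
    rw [Real.finsetProd_rpow _ _ fun i _ => norm_nonneg _]

/-- What is needed of a function for its anchored and ANOVA norms to make sense. -/
structure Nice {d : ℕ} (p : ℝ≥0∞) (f : (Fin d → unitInterval) → ℂ) : Prop where
  reg : ∃ D : Set unitInterval, (∀ᵐ s, s ∈ D) ∧ Reg D f
  integrable : ∀ u : Finset (Fin d), ∀ᵐ x : {j // j ∈ u} → unitInterval,
    Integrable (fun t : {j // j ∉ u} → unitInterval => mixedDeriv u f (glue u x t)) volume
  anchored : ∀ u : Finset (Fin d), MemLp (anchoredPart u f) p volume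
  anova : ∀ u : Finset (Fin d), MemLp (anovaPart u f) p volume

theorem mixedDeriv_tensor_glue {d : ℕ} (h : Fin d → unitInterval → ℂ) (u : Finset (Fin d))
    (x : {j // j ∈ u} → unitInterval) (t : {j // j ∉ u} → unitInterval) :
    mixedDeriv u (tensor h) (glue u x t) =
      (∏ j : {j // j ∈ u}, deriv01 (h j) (x j)) * ∏ j : {j // j ∉ u}, h j (t j) := by
  rw [mixedDeriv, iterDeriv_tensor h _ (Finset.sort_nodup _ _),
    ← Fintype.prod_subtype_mul_prod_subtype (fun j => j ∈ u)]
  congr 1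
  · refine Finset.prod_congr (by ext; simp) fun j _ => ?_
    simp [glue, j.2]
  · refine Finset.prod_congr rfl fun j _ => ?_
    simp [glue, j.2]

theorem Nice.tensor {d : ℕ} {p : ℝ≥0∞} {h : Fin d → unitInterval → ℂ}
    (hh : ∀ j, IsUnivariate p (h j)) : Nice p (tensor h) where
  reg := by
    refine ⟨{s | ∀ j, DifferentiableWithinAt ℝ (extendReal (h j)) (Icc 0 1) s}, ?_, ?_⟩
    · exact ae_all_iff.2 fun j => (hh j).ae_differentiable
    · exact Reg.tensor fun j x hx => hx j
  integrable u := by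
    refine ae_of_all _ fun x => ?_
    simp only [mixedDeriv_tensor_glue]
    refine Integrable.const_mul ?_ _
    exact Integrable.fintype_prod fun j : {j // j ∉ u} =>
      (hh j).continuous.integrable_of_hasCompactSupport (HasCompactSupport.of_compactSpace _)
  anchored u := by
    unfold anchoredPart
    simp only [mixedDeriv_tensor_glue]
    exact (memLp_tensor fun j : {j // j ∈ u} => (hh j).memLp_deriv).mul_const _
  anova u := by
    unfold anovaPart
    simp only [mixedDeriv_tensor_glue, integral_const_mul]
    exact (memLp_tensor fun j : {j // j ∈ u} => (hh j).memLp_deriv).mul_const _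

theorem Nice.ae_add {d : ℕ} {p : ℝ≥0∞} {f g : (Fin d → unitInterval) → ℂ} (hf : Nice p f)
    (hg : Nice p g) (u : Finset (Fin d)) : ∀ᵐ x : {j // j ∈ u} → unitInterval,
      ∀ t, mixedDeriv u (f + g) (glue u x t) =
        mixedDeriv u f (glue u x t) + mixedDeriv u g (glue u x t) := by
  obtain ⟨D, hD, hfD⟩ := hf.reg
  obtain ⟨E, hE, hgE⟩ := hg.reg
  have : ∀ᵐ x : {j // j ∈ u} → unitInterval, ∀ j, x j ∈ D ∩ E :=
    ae_all_iff.2 fun j => (Measure.quasiMeasurePreserving_eval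
      (fun _ : {j // j ∈ u} => (volume : Measure unitInterval)) j).ae (hD.and hE)
  filter_upwards [this] with x hx t
  refine iterDeriv_add (hfD.mono inter_subset_left) (hgE.mono inter_subset_right) _
    (Finset.sort_nodup _ _) _ fun j hj => ?_
  rw [Finset.mem_sort] at hj
  simpa [glue, hj] using hx ⟨j, hj⟩

theorem Nice.anchoredPart_add {d : ℕ} {p : ℝ≥0∞} {f g : (Fin d → unitInterval) → ℂ}
    (hf : Nice p f) (hg : Nice p g) (u : Finset (Fin d)) :
    anchoredPart u (f + g) =ᵐ[volume] anchoredPart u f + anchoredPart u g := by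
  filter_upwards [hf.ae_add hg u] with x hx
  exact hx 0

theorem Nice.anovaPart_add {d : ℕ} {p : ℝ≥0∞} {f g : (Fin d → unitInterval) → ℂ}
    (hf : Nice p f) (hg : Nice p g) (u : Finset (Fin d)) :
    anovaPart u (f + g) =ᵐ[volume] anovaPart u f + anovaPart u g := by
  filter_upwards [hf.ae_add hg u, hf.integrable u, hg.integrable u] with x hx h1 h2
  simp only [anovaPart, Pi.add_apply, hx]
  exact integral_add h1 h2

theorem anchoredPart_smul {d : ℕ} (c : ℂ) (f : (Fin d → unitInterval) → ℂ) (u : Finset (Fin d)) :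
    anchoredPart u (c • f) = c • anchoredPart u f := by
  funext x
  simp only [anchoredPart, mixedDeriv, iterDeriv_smul, Pi.smul_apply]

theorem anovaPart_smul {d : ℕ} (c : ℂ) (f : (Fin d → unitInterval) → ℂ) (u : Finset (Fin d)) :
    anovaPart u (c • f) = c • anovaPart u f := by
  funext x
  simp only [anovaPart, mixedDeriv, iterDeriv_smul, Pi.smul_apply]
  exact integral_smul c _

theorem Nice.add {d : ℕ} {p : ℝ≥0∞} {f g : (Fin d → unitInterval) → ℂ} (hf : Nice p f)
    (hg : Nice p g) : Nice p (f + g) where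
  reg := by
    obtain ⟨D, hD, hfD⟩ := hf.reg
    obtain ⟨E, hE, hgE⟩ := hg.reg
    exact ⟨D ∩ E, hD.and hE, (hfD.mono inter_subset_left).add (hgE.mono inter_subset_right)⟩
  integrable u := by
    filter_upwards [hf.ae_add hg u, hf.integrable u, hg.integrable u] with x hx h1 h2
    simp only [hx]
    exact h1.add h2
  anchored u := ((hf.anchored u).add (hg.anchored u)).ae_eq (hf.anchoredPart_add hg u).symm
  anova u := ((hf.anova u).add (hg.anova u)).ae_eq (hf.anovaPart_add hg u).symm

theorem Nice.smul {d : ℕ} {p : ℝ≥0∞} {f : (Fin d → unitInterval) → ℂ} (c : ℂ) (hf : Nice p f) :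
    Nice p (c • f) where
  reg := by
    obtain ⟨D, hD, hfD⟩ := hf.reg
    exact ⟨D, hD, hfD.smul c⟩
  integrable u := by
    filter_upwards [hf.integrable u] with x hx
    simp only [mixedDeriv, iterDeriv_smul]
    exact hx.smul c
  anchored u := by
    rw [anchoredPart_smul]
    exact (hf.anchored u).const_smul c
  anova u := by
    rw [anovaPart_smul]
    exact (hf.anova u).const_smul c

theorem nice_zero {d : ℕ} {p : ℝ≥0∞} : Nice p (0 : (Fin d → unitInterval) → ℂ) := by
  have hz : ∀ l : List (Fin d), iterDeriv l (0 : (Fin d → unitInterval) → ℂ) = 0 := by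
    intro l
    have h := iterDeriv_smul 0 (0 : (Fin d → unitInterval) → ℂ) l
    rwa [zero_smul, zero_smul] at h
  refine ⟨⟨univ, by simp, ?_⟩, fun u => ?_, fun u => ?_, fun u => ?_⟩
  · intro l _ j _ x _ _
    simp only [hz]
    exact differentiableWithinAt_const (0 : ℂ)
  · simp [mixedDeriv, hz]
  · have : anchoredPart u (0 : (Fin d → unitInterval) → ℂ) = 0 := by
      funext x; simp [anchoredPart, mixedDeriv, hz]
    rw [this]
    exact MemLp.zero
  · have : anovaPart u (0 : (Fin d → unitInterval) → ℂ) = 0 := by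
      funext x; simp [anovaPart, mixedDeriv, hz]
    rw [this]
    exact MemLp.zero

theorem nice_of_mem {d : ℕ} {p : ℝ≥0∞} (f : TensorSpace d p) :
    Nice p (f : (Fin d → unitInterval) → ℂ) := by
  refine Submodule.span_induction (p := fun f _ => Nice p f) ?_ nice_zero
    (fun _ _ _ _ hf hg => hf.add hg) (fun c _ _ hf => hf.smul c) f.2
  rintro _ ⟨h, hh, rfl⟩
  exact Nice.tensor hh

/-! ### The anchored and ANOVA norms and the completed spaces -/

/-- The space of tuples `(g_u)_{u ⊆ [d]}` with `g_u ∈ L_p([0,1]^u)`, with the (unweighted)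
`ℓ_p`-norm `(∑_u ‖g_u‖_p^p)^{1/p}` (a maximum if `p = ∞`). -/
abbrev Components (d : ℕ) (p : ℝ≥0∞) : Type :=
  PiLp p fun u : Finset (Fin d) =>
    Lp ℂ p (volume : Measure ({j : Fin d // j ∈ u} → unitInterval))

/-- The Anchored component of `f` with index `u`, as an element of `L_p([0,1]^u)`. -/
def anchoredLp {d : ℕ} {p : ℝ≥0∞} (u : Finset (Fin d)) (f : TensorSpace d p) :
    Lp ℂ p (volume : Measure ({j : Fin d // j ∈ u} → unitInterval)) :=
  ((nice_of_mem f).anchored u).toLp (anchoredPart u f)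

theorem anchoredLp_add {d : ℕ} {p : ℝ≥0∞} (u : Finset (Fin d)) (f g : TensorSpace d p) :
    anchoredLp u (f + g) = anchoredLp u f + anchoredLp u g :=
  (MemLp.toLp_congr _ (((nice_of_mem f).anchored u).add ((nice_of_mem g).anchored u))
    ((nice_of_mem f).anchoredPart_add (nice_of_mem g) u)).trans (MemLp.toLp_add _ _)

theorem anchoredLp_smul {d : ℕ} {p : ℝ≥0∞} (u : Finset (Fin d)) (c : ℂ) (f : TensorSpace d p) :
    anchoredLp u (c • f) = c • anchoredLp u f :=
  (MemLp.toLp_congr _ (((nice_of_mem f).anchored u).const_smul c)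
    (ae_of_all _ fun x => congrFun (anchoredPart_smul c f u) x)).trans (MemLp.toLp_const_smul _ _)

/-- The linear map `f ↦ (γ_u⁻¹ f^{(u)}(·_u; 0))_u`, for positive weights `γ_u`. -/
def anchoredMap {d : ℕ} (p : ℝ≥0∞) [Fact (1 ≤ p)] (γ : Finset (Fin d) → ℝ) :
    TensorSpace d p →ₗ[ℂ] Components d p where
  toFun f := WithLp.toLp p fun u => ((γ u)⁻¹ : ℂ) • anchoredLp u f
  map_add' f g := by
    ext1 u
    change ((γ u)⁻¹ : ℂ) • anchoredLp u (f + g) =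
      ((γ u)⁻¹ : ℂ) • anchoredLp u f + ((γ u)⁻¹ : ℂ) • anchoredLp u g
    rw [anchoredLp_add, smul_add]
  map_smul' c f := by
    ext1 u
    change ((γ u)⁻¹ : ℂ) • anchoredLp u (c • f) = c • (((γ u)⁻¹ : ℂ) • anchoredLp u f)
    rw [anchoredLp_smul, smul_comm]

/-- The ANOVA component of `f` with index `u`, as an element of `L_p([0,1]^u)`. -/
def anovaLp {d : ℕ} {p : ℝ≥0∞} (u : Finset (Fin d)) (f : TensorSpace d p) :
    Lp ℂ p (volume : Measure ({j : Fin d // j ∈ u} → unitInterval)) :=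
  ((nice_of_mem f).anova u).toLp (anovaPart u f)

theorem anovaLp_add {d : ℕ} {p : ℝ≥0∞} (u : Finset (Fin d)) (f g : TensorSpace d p) :
    anovaLp u (f + g) = anovaLp u f + anovaLp u g :=
  (MemLp.toLp_congr _ (((nice_of_mem f).anova u).add ((nice_of_mem g).anova u))
    ((nice_of_mem f).anovaPart_add (nice_of_mem g) u)).trans (MemLp.toLp_add _ _)

theorem anovaLp_smul {d : ℕ} {p : ℝ≥0∞} (u : Finset (Fin d)) (c : ℂ) (f : TensorSpace d p) :
    anovaLp u (c • f) = c • anovaLp u f :=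
  (MemLp.toLp_congr _ (((nice_of_mem f).anova u).const_smul c)
    (ae_of_all _ fun x => congrFun (anovaPart_smul c f u) x)).trans (MemLp.toLp_const_smul _ _)

/-- The linear map `f ↦ (γ_u⁻¹ ∫_{[0,1]^{[d] ∖ u}} f^{(u)}(·_u; t) dt)_u`, for positive weights
`γ_u`. -/
def anovaMap {d : ℕ} (p : ℝ≥0∞) [Fact (1 ≤ p)] (γ : Finset (Fin d) → ℝ) :
    TensorSpace d p →ₗ[ℂ] Components d p where
  toFun f := WithLp.toLp p fun u => ((γ u)⁻¹ : ℂ) • anovaLp u f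
  map_add' f g := by
    ext1 u
    change ((γ u)⁻¹ : ℂ) • anovaLp u (f + g) =
      ((γ u)⁻¹ : ℂ) • anovaLp u f + ((γ u)⁻¹ : ℂ) • anovaLp u g
    rw [anovaLp_add, smul_add]
  map_smul' c f := by
    ext1 u
    change ((γ u)⁻¹ : ℂ) • anovaLp u (c • f) = c • (((γ u)⁻¹ : ℂ) • anovaLp u f)
    rw [anovaLp_smul, smul_comm]

/-- The tensor product space with the anchored norm for the positive weights `γ`. -/
def AnchoredTensor {d : ℕ} (p : ℝ≥0∞) (_γ : Finset (Fin d) → ℝ) : Type := TensorSpace d p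

/-- The tensor product space with the ANOVA norm for the positive weights `γ`. -/
def AnovaTensor {d : ℕ} (p : ℝ≥0∞) (_γ : Finset (Fin d) → ℝ) : Type := TensorSpace d p

section instances

variable {d : ℕ} (p : ℝ≥0∞) (γ : Finset (Fin d) → ℝ)

instance : AddCommGroup (AnchoredTensor p γ) := inferInstanceAs (AddCommGroup (TensorSpace d p))
instance : Module ℂ (AnchoredTensor p γ) := inferInstanceAs (Module ℂ (TensorSpace d p))
instance : AddCommGroup (AnovaTensor p γ) := inferInstanceAs (AddCommGroup (TensorSpace d p))
instance : Module ℂ (AnovaTensor p γ) := inferInstanceAs (Module ℂ (TensorSpace d p))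

variable [Fact (1 ≤ p)]

instance : SeminormedAddCommGroup (AnchoredTensor p γ) :=
  SeminormedAddCommGroup.induced (AnchoredTensor p γ) (Components d p)
    (anchoredMap p γ : AnchoredTensor p γ →ₗ[ℂ] Components d p)
instance : NormedSpace ℂ (AnchoredTensor p γ) :=
  NormedSpace.induced ℂ (AnchoredTensor p γ) (Components d p)
    (anchoredMap p γ : AnchoredTensor p γ →ₗ[ℂ] Components d p)
instance : SeminormedAddCommGroup (AnovaTensor p γ) :=
  SeminormedAddCommGroup.induced (AnovaTensor p γ) (Components d p)
    (anovaMap p γ : AnovaTensor p γ →ₗ[ℂ] Components d p)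
instance : NormedSpace ℂ (AnovaTensor p γ) :=
  NormedSpace.induced ℂ (AnovaTensor p γ) (Components d p)
    (anovaMap p γ : AnovaTensor p γ →ₗ[ℂ] Components d p)

end instances

/-- The anchored space: the completion of the tensor product in the anchored norm. -/
abbrev AnchoredSpace {d : ℕ} (p : ℝ≥0∞) [Fact (1 ≤ p)] (γ : Finset (Fin d) → ℝ) : Type :=
  UniformSpace.Completion (AnchoredTensor p γ)

/-- The ANOVA space: the completion of the tensor product in the ANOVA norm. -/
abbrev AnovaSpace {d : ℕ} (p : ℝ≥0∞) [Fact (1 ≤ p)] (γ : Finset (Fin d) → ℝ) : Type :=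
  UniformSpace.Completion (AnovaTensor p γ)

/-- An element of the tensor product, as an element of the anchored space. -/
def toAnchored {d : ℕ} (p : ℝ≥0∞) [Fact (1 ≤ p)] (γ : Finset (Fin d) → ℝ) (f : TensorSpace d p) :
    AnchoredSpace p γ :=
  ((show AnchoredTensor p γ from f : AnchoredTensor p γ) : AnchoredSpace p γ)

/-- An element of the tensor product, as an element of the ANOVA space. -/
def toAnova {d : ℕ} (p : ℝ≥0∞) [Fact (1 ≤ p)] (γ : Finset (Fin d) → ℝ) (f : TensorSpace d p) :
    AnovaSpace p γ :=
  ((show AnovaTensor p γ from f : AnovaTensor p γ) : AnovaSpace p γ)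

/-- The weighted norm of a tuple `(γ_u⁻¹ g_u)_u`, for `p < ∞`. -/
theorem norm_components {d : ℕ} (p : ℝ≥0∞) [Fact (1 ≤ p)] (hp : p ≠ ∞)
    (γ : Finset (Fin d) → ℝ) (hγ : ∀ u, 0 < γ u)
    (g : ∀ u : Finset (Fin d), ({j // j ∈ u} → unitInterval) → ℂ) (hg : ∀ u, MemLp (g u) p volume) :
    ‖(WithLp.toLp p fun u => ((γ u)⁻¹ : ℂ) • (hg u).toLp (g u) : Components d p)‖ =
      (∑ u, γ u ^ (-p.toReal) *
        ∫ x : {j // j ∈ u} → unitInterval, ‖g u x‖ ^ p.toReal) ^ (1 / p.toReal) := by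
  have hp0 : p ≠ 0 := (zero_lt_one.trans_le (Fact.out : 1 ≤ p)).ne'
  have hpos : 0 < p.toReal := ENNReal.toReal_pos hp0 hp
  rw [PiLp.norm_eq_sum hpos]
  congr 1
  refine Finset.sum_congr rfl fun u _ => ?_
  change ‖((γ u)⁻¹ : ℂ) • (hg u).toLp (g u)‖ ^ p.toReal = _
  have hI : 0 ≤ ∫ x : {j // j ∈ u} → unitInterval, ‖g u x‖ ^ p.toReal :=
    integral_nonneg fun x => Real.rpow_nonneg (norm_nonneg _) _
  rw [norm_smul, Lp.norm_toLp, (hg u).eLpNorm_eq_integral_rpow_norm hp0 hp,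
    ENNReal.toReal_ofReal (Real.rpow_nonneg hI _), norm_inv, Complex.norm_real,
    Real.norm_of_nonneg (hγ u).le,
    Real.mul_rpow (inv_nonneg.2 (hγ u).le) (Real.rpow_nonneg hI _),
    Real.rpow_inv_rpow hI hpos.ne', Real.rpow_neg (hγ u).le, Real.inv_rpow (hγ u).le]

/-- The weighted norm of a tuple `(γ_u⁻¹ g_u)_u`, for `p = ∞`. -/
theorem norm_components_top {d : ℕ} (γ : Finset (Fin d) → ℝ) (hγ : ∀ u, 0 < γ u)
    (g : ∀ u : Finset (Fin d), ({j // j ∈ u} → unitInterval) → ℂ) (hg : ∀ u, MemLp (g u) ∞ volume) :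
    ‖(WithLp.toLp ∞ fun u => ((γ u)⁻¹ : ℂ) • (hg u).toLp (g u) : Components d ∞)‖ =
      ⨆ u, (γ u)⁻¹ * (eLpNorm (g u) ∞ volume).toReal := by
  rw [PiLp.norm_eq_ciSup]
  congr 1
  funext u
  change ‖((γ u)⁻¹ : ℂ) • (hg u).toLp (g u)‖ = _
  rw [norm_smul, Lp.norm_toLp, norm_inv, Complex.norm_real, Real.norm_of_nonneg (hγ u).le]

/-- The anchored norm
`(∑_u γ_u^{-p} ∫_{[0,1]^u} |f^{(u)}(x_u;0)|^p dx_u)^{1/p}`, for `p < ∞`. -/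
theorem norm_toAnchored {d : ℕ} (p : ℝ≥0∞) [Fact (1 ≤ p)] (hp : p ≠ ∞)
    (γ : Finset (Fin d) → ℝ) (hγ : ∀ u, 0 < γ u) (f : TensorSpace d p) :
    ‖toAnchored p γ f‖ = (∑ u, γ u ^ (-p.toReal) *
      ∫ x : {j // j ∈ u} → unitInterval, ‖anchoredPart u f x‖ ^ p.toReal) ^ (1 / p.toReal) :=
  (UniformSpace.Completion.norm_coe _).trans
    (norm_components p hp γ hγ _ fun u => (nice_of_mem f).anchored u)

/-- The anchored norm for `p = ∞`. -/
theorem norm_toAnchored_top {d : ℕ} (γ : Finset (Fin d) → ℝ) (hγ : ∀ u, 0 < γ u)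
    (f : TensorSpace d ∞) :
    ‖toAnchored ∞ γ f‖ = ⨆ u, (γ u)⁻¹ * (eLpNorm (anchoredPart u f) ∞ volume).toReal :=
  (UniformSpace.Completion.norm_coe _).trans
    (norm_components_top γ hγ _ fun u => (nice_of_mem f).anchored u)

/-- The ANOVA norm
`(∑_u γ_u^{-p} ∫_{[0,1]^u} |∫_{[0,1]^{[d] ∖ u}} f^{(u)}(x_u;t) dt|^p dx_u)^{1/p}`, for `p < ∞`. -/
theorem norm_toAnova {d : ℕ} (p : ℝ≥0∞) [Fact (1 ≤ p)] (hp : p ≠ ∞)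
    (γ : Finset (Fin d) → ℝ) (hγ : ∀ u, 0 < γ u) (f : TensorSpace d p) :
    ‖toAnova p γ f‖ = (∑ u, γ u ^ (-p.toReal) *
      ∫ x : {j // j ∈ u} → unitInterval, ‖anovaPart u f x‖ ^ p.toReal) ^ (1 / p.toReal) :=
  (UniformSpace.Completion.norm_coe _).trans
    (norm_components p hp γ hγ _ fun u => (nice_of_mem f).anova u)

/-- The ANOVA norm for `p = ∞`. -/
theorem norm_toAnova_top {d : ℕ} (γ : Finset (Fin d) → ℝ) (hγ : ∀ u, 0 < γ u)
    (f : TensorSpace d ∞) :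
    ‖toAnova ∞ γ f‖ = ⨆ u, (γ u)⁻¹ * (eLpNorm (anovaPart u f) ∞ volume).toReal :=
  (UniformSpace.Completion.norm_coe _).trans
    (norm_components_top γ hγ _ fun u => (nice_of_mem f).anova u)

/-- Uniform equivalence (in the dimension) of the anchored and the ANOVA spaces with positive
weights `γ_{d,u}`, `u ⊆ [d]`: there is a constant `c > 0` such that for every dimension `d` the
identity map of the tensor product extends to an isomorphism `J` of the completed spaces such that
`J` and its inverse have operator norm at most `c`. -/
def UniformlyEquivalent (p : ℝ≥0∞) [Fact (1 ≤ p)] (γ : ∀ d : ℕ, Finset (Fin d) → ℝ) : Prop :=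
  ∃ c : ℝ, 0 < c ∧ ∀ d : ℕ, 1 ≤ d →
    ∃ J : AnchoredSpace p (γ d) ≃L[ℂ] AnovaSpace p (γ d),
      (∀ f : TensorSpace d p, J (toAnchored p (γ d) f) = toAnova p (γ d) f) ∧
      ‖(J : AnchoredSpace p (γ d) →L[ℂ] AnovaSpace p (γ d))‖ ≤ c ∧
      ‖(J.symm : AnovaSpace p (γ d) →L[ℂ] AnchoredSpace p (γ d))‖ ≤ c

end MixedSmoothness

end

noncomputable section
namespace MixedSmoothness

/-! ### The mean value of an absolutely continuous function -/

/-! In one variable, integration by parts gives `∫ f = f(0) + ∫ (1 - t) f'(t) dt`: the mean value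
and the value at the anchor differ by an integral of `f'` against a kernel bounded by `1`.

For an elementary tensor, the anchored and ANOVA components with index `u` are the same function
`∏_{j ∈ u} h_j'`, multiplied by `∏_{j ∉ u} h_j(0)` and `∏_{j ∉ u} ∫ h_j` respectively. Substituting
the univariate identity in each factor and expanding the product over `w ⊆ uᶜ` yields, by linearity
for every `f` in the tensor space, that the component `B_u f` of one kind is the sum over `w`
disjoint from `u` of `T_{u,w} A_{u ∪ w} f`, with `A` the other kind (`eq_sum_transfer`). Here
`T_{u,w}` integrates out the variables in `w` against `∏_{j ∈ w} c (1 - y_j)`, with `c = 1` in one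
direction and `c = -1` in the other. By Jensen's inequality `T_{u,w}` is a contraction on `L_p` for
every `p ≥ 1` (`norm_transfer_le`).

The weights satisfy `γ_u⁻¹ = d^{|u|} = d^{-|w|} γ_{u ∪ w}⁻¹`. For fixed `w` the map `u ↦ u ∪ w` is
injective on the sets disjoint from `w`, so the tuple of all terms with this `w` has norm at most
`d^{-|w|}` times the norm of `f`. Summing over `w` gives the factor `(1 + 1/d)^d ≤ e` in both
directions (`norm_components_le`), and density carries the two bounds to the completions. -/

theorem _root_.AbsolutelyContinuousOnInterval.clm_comp {f : ℝ → ℂ} {a b : ℝ}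
    (hf : AbsolutelyContinuousOnInterval f a b) (L : ℂ →L[ℝ] ℝ) (hL : ‖L‖ ≤ 1) :
    AbsolutelyContinuousOnInterval (fun x => L (f x)) a b := by
  refine squeeze_zero (fun _ => Finset.sum_nonneg fun _ _ => dist_nonneg)
    (fun E => Finset.sum_le_sum fun i _ => ?_) hf
  rw [dist_eq_norm, ← map_sub, dist_eq_norm]
  exact (L.le_of_opNorm_le hL _).trans_eq (one_mul _)

/-- The kernel `1 - t` relating the mean value of a function to its value at `0`. -/
def kernel (t : unitInterval) : ℂ := ((1 - (t : ℝ) : ℝ) : ℂ)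

theorem continuous_kernel : Continuous kernel := by
  unfold kernel
  fun_prop

theorem norm_kernel_le (t : unitInterval) : ‖kernel t‖ ≤ 1 := by
  rw [kernel, Complex.norm_real, Real.norm_of_nonneg (sub_nonneg.2 t.2.2)]
  linarith [t.2.1]

theorem integral_unitInterval {E : Type*} [NormedAddCommGroup E] [NormedSpace ℝ E] (F : ℝ → E) :
    ∫ t : unitInterval, F t = ∫ t in (0 : ℝ)..1, F t := by
  rw [unitInterval.measurePreserving_coe.integral_comp unitInterval.measurableEmbedding_coe F,
    intervalIntegral.integral_of_le zero_le_one, integral_Icc_eq_integral_Ioc]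

theorem IsUnivariate.integrable_deriv {p : ℝ≥0∞} (hp : 1 ≤ p) {f : unitInterval → ℂ}
    (hf : IsUnivariate p f) : Integrable (deriv01 f) :=
  hf.memLp_deriv.integrable hp

/-- Integration by parts for the real functions `1 - t` and `L ∘ f`. The factor `1 - t` vanishes at
`1`, so only the boundary term at `0` survives. -/
theorem IsUnivariate.integral_clm {p : ℝ≥0∞} {f : unitInterval → ℂ} (hf : IsUnivariate p f)
    (L : ℂ →L[ℝ] ℝ) (hL : ‖L‖ ≤ 1) :
    ∫ t : unitInterval, (1 - (t : ℝ)) * L (deriv01 f t) = (∫ t, L (f t)) - L (f 0) := by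
  have hac := hf.absCont.clm_comp L hL
  have hk : AbsolutelyContinuousOnInterval (fun t : ℝ => 1 - t) 0 1 := by
    have : LipschitzOnWith 1 (fun t : ℝ => 1 - t) (uIcc 0 1) := by
      refine LipschitzOnWith.of_dist_le_mul fun x _ y _ => ?_
      rw [Real.dist_eq, Real.dist_eq, sub_sub_sub_cancel_left, abs_sub_comm, NNReal.coe_one, one_mul]
    exact this.absolutelyContinuousOnInterval
  have key := hk.integral_mul_deriv_eq_deriv_mul hac
  have e1 : ∫ t : unitInterval, (1 - (t : ℝ)) * L (deriv01 f t) =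
      ∫ t in (0 : ℝ)..1, (1 - t) * deriv (fun x => L (extendReal f x)) t := by
    unfold deriv01
    rw [integral_unitInterval fun t => (1 - t) * L (derivWithin (extendReal f) (Icc 0 1) t)]
    refine intervalIntegral.integral_congr_ae ?_
    -- The one-sided derivative is compared with the two-sided one at interior points only: `t = 1`
    -- is discarded as a null set, and `0` is already outside the half-open interval.
    filter_upwards [hf.absCont.boundedVariationOn.ae_differentiableAt_of_mem_uIcc,
      Measure.ae_ne volume (1 : ℝ)] with t ht ht1 htm
    rw [uIoc_of_le zero_le_one] at htm
    have hd := ht (by rw [uIcc_of_le zero_le_one]; exact ⟨htm.1.le, htm.2⟩)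
    rw [derivWithin_of_mem_nhds (Icc_mem_nhds htm.1 (lt_of_le_of_ne htm.2 ht1))]
    congr 1
    exact ((L.hasFDerivAt.comp_hasDerivAt t hd.hasDerivAt).deriv).symm
  have e2 : ∫ t : unitInterval, L (f t) = ∫ t in (0 : ℝ)..1, L (extendReal f t) := by
    rw [← integral_unitInterval fun t => L (extendReal f t)]
    simp [extendReal]
  have e3 : ∀ t : ℝ, deriv (fun t : ℝ => 1 - t) t = -1 := fun t => by simp
  have e4 : extendReal f 0 = f 0 := by
    simp [extendReal]
  rw [e1, key, e2]
  simp [e3, e4, intervalIntegral.integral_neg]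
  ring

theorem IsUnivariate.integral_eq {p : ℝ≥0∞} (hp : 1 ≤ p) {f : unitInterval → ℂ}
    (hf : IsUnivariate p f) : ∫ t, f t = f 0 + ∫ t, kernel t * deriv01 f t := by
  have hi : Integrable fun t => kernel t * deriv01 f t :=
    (hf.integrable_deriv hp).bdd_mul continuous_kernel.aestronglyMeasurable
      (ae_of_all _ norm_kernel_le)
  have hf' : Integrable f :=
    hf.continuous.integrable_of_hasCompactSupport (HasCompactSupport.of_compactSpace _)
  -- The complex identity is tested on real functionals of norm at most `1`; the real and imaginary
  -- parts suffice.
  have main : ∀ L : ℂ →L[ℝ] ℝ, ‖L‖ ≤ 1 → L (∫ t, f t) = L (f 0 + ∫ t, kernel t * deriv01 f t) := by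
    intro L hL
    rw [map_add, ← L.integral_comp_comm hi, ← L.integral_comp_comm hf']
    have : ∀ t, L (kernel t * deriv01 f t) = (1 - (t : ℝ)) * L (deriv01 f t) := fun t => by
      rw [kernel, ← Complex.real_smul, map_smul, smul_eq_mul]
    simp only [this, hf.integral_clm L hL]
    ring
  exact Complex.ext (main Complex.reCLM Complex.reCLM_norm.le)
    (main Complex.imCLM Complex.imCLM_norm.le)

/-! ### Partial integration against a bounded kernel -/

section PartialIntegral

variable {X Y : Type*} [MeasurableSpace X] [MeasurableSpace Y] {μ : Measure X} {ν : Measure Y}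

/-- Jensen's inequality on each fibre: since `ν` has mass one, the `L_1` norm of `g (x, ·)` is at
most its `L_p` norm, and Tonelli integrates the `p`-th powers over `x`. For `p = ∞` almost every
fibre is bounded by the essential supremum of `g`. -/
theorem eLpNorm_integral_prod_le [SFinite μ] [IsProbabilityMeasure ν] {p : ℝ≥0∞} (hp : 1 ≤ p)
    {k : Y → ℂ} (hk : ∀ y, ‖k y‖ ≤ 1) {g : X × Y → ℂ} (hg : AEStronglyMeasurable g (μ.prod ν)) :
    eLpNorm (fun x => ∫ y, k y * g (x, y) ∂ν) p μ ≤ eLpNorm g p (μ.prod ν) := by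
  have hle : ∀ x, ‖∫ y, k y * g (x, y) ∂ν‖ₑ ≤ ∫⁻ y, ‖g (x, y)‖ₑ ∂ν := fun x =>
    (enorm_integral_le_lintegral_enorm _).trans <| lintegral_mono fun y => by
      rw [enorm_mul]
      refine mul_le_of_le_one_left' ?_
      rw [← ofReal_norm]
      exact ENNReal.ofReal_le_one.2 (hk y)
  rcases eq_or_ne p ∞ with rfl | htop
  · simp only [eLpNorm_exponent_top]
    refine essSup_le_of_ae_le _ ?_
    filter_upwards [Measure.ae_ae_of_ae_prod (ae_le_eLpNormEssSup (f := g) (μ := μ.prod ν))]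
      with x hx
    exact (hle x).trans ((lintegral_mono_ae hx).trans_eq (by simp))
  · have hp0 : p ≠ 0 := (zero_lt_one.trans_le hp).ne'
    have hpos : 0 < p.toReal := ENNReal.toReal_pos hp0 htop
    rw [eLpNorm_eq_lintegral_rpow_enorm_toReal hp0 htop,
      eLpNorm_eq_lintegral_rpow_enorm_toReal hp0 htop, lintegral_prod _ (hg.enorm.pow_const _)]
    gcongr ?_ ^ _
    refine lintegral_mono_ae ?_
    filter_upwards [hg.prodMk_left] with x hx
    have h1 := eLpNorm_le_eLpNorm_of_exponent_le hp hx
    rw [eLpNorm_one_eq_lintegral_enorm, eLpNorm_eq_lintegral_rpow_enorm_toReal hp0 htop] at h1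
    calc _ ≤ ((∫⁻ y, ‖g (x, y)‖ₑ ^ p.toReal ∂ν) ^ (1 / p.toReal)) ^ p.toReal := by
          gcongr
          exact (hle x).trans h1
      _ = _ := by rw [← ENNReal.rpow_mul, one_div_mul_cancel hpos.ne', ENNReal.rpow_one]

variable [SFinite μ] [IsProbabilityMeasure ν] {p : ℝ≥0∞}

theorem memLp_integral_prod (hp : 1 ≤ p) {k : Y → ℂ} (hkm : AEStronglyMeasurable k ν)
    (hk : ∀ y, ‖k y‖ ≤ 1) {g : X × Y → ℂ} (hg : MemLp g p (μ.prod ν)) :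
    MemLp (fun x => ∫ y, k y * g (x, y) ∂ν) p μ :=
  ⟨(hkm.comp_snd.mul hg.1).integral_prod_right',
    (eLpNorm_integral_prod_le hp hk hg.1).trans_lt hg.2⟩

theorem ae_integrable_kernel_mul [IsFiniteMeasure μ] (hp : 1 ≤ p) {k : Y → ℂ}
    (hkm : AEStronglyMeasurable k ν) (hk : ∀ y, ‖k y‖ ≤ 1) {g : X × Y → ℂ}
    (hg : MemLp g p (μ.prod ν)) : ∀ᵐ x ∂μ, Integrable (fun y => k y * g (x, y)) ν := by
  filter_upwards [(hg.integrable hp).prod_right_ae] with x hx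
  exact hx.bdd_mul hkm (ae_of_all _ hk)

variable [IsFiniteMeasure μ] [hp : Fact (1 ≤ p)]

/-- Integration in the second variable against a kernel bounded by `1`, as a linear map on `L_p`. -/
def partialIntegralₗ (k : Y → ℂ) (hkm : AEStronglyMeasurable k ν) (hk : ∀ y, ‖k y‖ ≤ 1) :
    Lp ℂ p (μ.prod ν) →ₗ[ℂ] Lp ℂ p μ where
  toFun g := (memLp_integral_prod hp.out hkm hk (Lp.memLp g)).toLp _
  map_add' f g := by
    rw [← MemLp.toLp_add]
    refine MemLp.toLp_congr _ _ ?_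
    filter_upwards [Measure.ae_ae_of_ae_prod (Lp.coeFn_add f g),
      ae_integrable_kernel_mul hp.out hkm hk (Lp.memLp f),
      ae_integrable_kernel_mul hp.out hkm hk (Lp.memLp g)] with x hx hf hg
    rw [Pi.add_apply, ← integral_add hf hg]
    refine integral_congr_ae ?_
    filter_upwards [hx] with y hy
    rw [hy, Pi.add_apply, mul_add]
  map_smul' c g := by
    rw [RingHom.id_apply, ← MemLp.toLp_const_smul]
    refine MemLp.toLp_congr _ _ ?_
    filter_upwards [Measure.ae_ae_of_ae_prod (Lp.coeFn_smul c g)] with x hx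
    rw [Pi.smul_apply, ← integral_smul]
    refine integral_congr_ae ?_
    filter_upwards [hx] with y hy
    rw [hy, Pi.smul_apply, smul_eq_mul, smul_eq_mul, mul_left_comm]

theorem norm_partialIntegralₗ_le {k : Y → ℂ} (hkm : AEStronglyMeasurable k ν)
    (hk : ∀ y, ‖k y‖ ≤ 1) (g : Lp ℂ p (μ.prod ν)) : ‖partialIntegralₗ k hkm hk g‖ ≤ ‖g‖ := by
  change ‖(memLp_integral_prod hp.out hkm hk (Lp.memLp g)).toLp _‖ ≤ _
  rw [Lp.norm_toLp, Lp.norm_def]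
  exact ENNReal.toReal_mono (Lp.memLp g).2.ne (eLpNorm_integral_prod_le hp.out hk (Lp.memLp g).1)

theorem partialIntegralₗ_toLp {k : Y → ℂ} (hkm : AEStronglyMeasurable k ν)
    (hk : ∀ y, ‖k y‖ ≤ 1) {g : X × Y → ℂ} (hg : MemLp g p (μ.prod ν)) :
    partialIntegralₗ k hkm hk (hg.toLp g) = (memLp_integral_prod hp.out hkm hk hg).toLp _ := by
  refine MemLp.toLp_congr (memLp_integral_prod hp.out hkm hk (Lp.memLp _)) _ ?_
  filter_upwards [Measure.ae_ae_of_ae_prod hg.coeFn_toLp] with x hx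
  refine integral_congr_ae ?_
  filter_upwards [hx] with y hy
  rw [hy]

end PartialIntegral

/-! ### Norms of tuples -/

/-- Reindexing along an injection only omits nonnegative terms of the `ℓ_p` sum, so the entrywise
constant is kept whatever `p` is. It serves for `σ u = u ∪ w` with `w` fixed. -/
theorem norm_piLp_le_of_injOn {ι : Type*} [Fintype ι] {E : ι → Type*}
    [∀ i, SeminormedAddCommGroup (E i)] {p : ℝ≥0∞} [hp : Fact (1 ≤ p)] {a b : PiLp p E} {c : ℝ}
    (hc : 0 ≤ c) (S : Finset ι) {σ : ι → ι} (hσ : InjOn σ S)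
    (h : ∀ i ∈ S, ‖a i‖ ≤ c * ‖b (σ i)‖) (h0 : ∀ i ∉ S, ‖a i‖ = 0) : ‖a‖ ≤ c * ‖b‖ := by
  classical
  rcases eq_or_ne p ∞ with rfl | htop
  · rw [PiLp.norm_eq_ciSup]
    refine Real.iSup_le (fun i => ?_) (by positivity)
    by_cases hi : i ∈ S
    · exact (h i hi).trans (by gcongr; exact PiLp.norm_apply_le b _)
    · rw [h0 i hi]
      positivity
  · have hpos : 0 < p.toReal := ENNReal.toReal_pos (zero_lt_one.trans_le hp.out).ne' htop
    rw [PiLp.norm_eq_sum hpos, PiLp.norm_eq_sum hpos]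
    have hb : 0 ≤ ∑ i, ‖b i‖ ^ p.toReal := by positivity
    rw [← Real.rpow_le_rpow_iff (by positivity) (by positivity) hpos,
      Real.mul_rpow hc (by positivity), ← Real.rpow_mul (by positivity),
      ← Real.rpow_mul hb, one_div_mul_cancel hpos.ne', Real.rpow_one, Real.rpow_one]
    calc ∑ i, ‖a i‖ ^ p.toReal = ∑ i ∈ S, ‖a i‖ ^ p.toReal := by
          refine (Finset.sum_subset (Finset.subset_univ S) fun i _ hi => ?_).symm
          rw [h0 i hi, Real.zero_rpow hpos.ne']
      _ ≤ ∑ i ∈ S, c ^ p.toReal * ‖b (σ i)‖ ^ p.toReal := by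
          refine Finset.sum_le_sum fun i hi => ?_
          rw [← Real.mul_rpow hc (norm_nonneg _)]
          exact Real.rpow_le_rpow (norm_nonneg _) (h i hi) hpos.le
      _ = c ^ p.toReal * ∑ i ∈ S.image σ, ‖b i‖ ^ p.toReal := by
          rw [Finset.sum_image hσ, Finset.mul_sum]
      _ ≤ c ^ p.toReal * ∑ i, ‖b i‖ ^ p.toReal := by
          gcongr
          exact Finset.subset_univ _

/-- By the binomial theorem the sum equals `(1 + 1/d)^d`. This is where the decay of the weights
gives a bound free of the dimension. -/
theorem sum_inv_pow_card_le_exp (d : ℕ) :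
    ∑ w : Finset (Fin d), ((d : ℝ) ^ w.card)⁻¹ ≤ Real.exp 1 := by
  have h : ∑ w : Finset (Fin d), ((d : ℝ) ^ w.card)⁻¹ = ((d : ℝ)⁻¹ + 1) ^ d := by
    have := Fintype.sum_pow_mul_eq_add_pow (Fin d) (d : ℝ)⁻¹ 1
    simpa using this
  rw [h]
  calc ((d : ℝ)⁻¹ + 1) ^ d ≤ Real.exp (d : ℝ)⁻¹ ^ d := by
        gcongr
        exact Real.add_one_le_exp _
    _ = Real.exp (d * (d : ℝ)⁻¹) := by rw [Real.exp_nat_mul]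
    _ ≤ Real.exp 1 := by
        gcongr
        -- This includes `d = 0`, where the product is `0`.
        exact mul_inv_le_one

/-! ### Passing between the components -/

section Transfer

variable {ι : Type*} {p : ℝ≥0∞}

/-- The product kernel `∏_{j ∈ w} c (1 - y_j)`. -/
def prodKernel (c : ℂ) (w : Finset ι) (y : {j // j ∈ w} → unitInterval) : ℂ :=
  ∏ j, c * kernel (y j)

theorem aestronglyMeasurable_prodKernel (c : ℂ) (w : Finset ι) :
    AEStronglyMeasurable (prodKernel c w) volume := by
  have : Continuous (prodKernel c w) :=
    continuous_finsetProd _ fun j _ =>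
      continuous_const.mul (continuous_kernel.comp (continuous_apply j))
  exact this.aestronglyMeasurable

theorem norm_prodKernel_le {c : ℂ} (hc : ‖c‖ ≤ 1) (w : Finset ι)
    (y : {j // j ∈ w} → unitInterval) : ‖prodKernel c w y‖ ≤ 1 := by
  rw [prodKernel, norm_prod]
  refine Finset.prod_le_one (fun _ _ => norm_nonneg _) fun j _ => ?_
  rw [norm_mul]
  exact mul_le_one₀ hc (norm_nonneg _) (norm_kernel_le _)

/-- The function `∏_{j ∈ u} φ_j(x_j)`, as an element of `L_p([0,1]^u)`. -/
def prodLp (u : Finset ι) {φ : ι → unitInterval → ℂ} (hφ : ∀ j, MemLp (φ j) p volume) :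
    Lp ℂ p (volume : Measure ({j // j ∈ u} → unitInterval)) :=
  (memLp_tensor fun j : {j // j ∈ u} => hφ j).toLp _

variable [DecidableEq ι]

/-- Gluing coordinates is reindexing along `u ⊕ w ≃ u ∪ w`, so a product function on the larger cube
separates into a factor on each block. -/
theorem prod_piFinsetUnion {u w : Finset ι} (h : Disjoint u w) (φ : ι → unitInterval → ℂ)
    (x : {j // j ∈ u} → unitInterval) (y : {j // j ∈ w} → unitInterval) :
    ∏ j : {j // j ∈ u ∪ w}, φ j (MeasurableEquiv.piFinsetUnion (fun _ => unitInterval) h (x, y) j) =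
      (∏ j : {j // j ∈ u}, φ j (x j)) * ∏ j : {j // j ∈ w}, φ j (y j) := by
  have e1 : ∀ j : {j // j ∈ u}, MeasurableEquiv.piFinsetUnion (fun _ => unitInterval) h (x, y)
      (Equiv.Finset.union u w h (Sum.inl j)) = x j := fun j =>
    Equiv.piFinsetUnion_left (fun _ => unitInterval) h j.2 (Finset.mem_union_left _ j.2)
  have e2 : ∀ j : {j // j ∈ w}, MeasurableEquiv.piFinsetUnion (fun _ => unitInterval) h (x, y)
      (Equiv.Finset.union u w h (Sum.inr j)) = y j := fun j =>
    Equiv.piFinsetUnion_right (fun _ => unitInterval) h j.2 (Finset.mem_union_right _ j.2)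
  rw [← (Equiv.Finset.union u w h).prod_comp, Fintype.prod_sum_type]
  simp only [e1, e2]
  rfl

variable [Fact (1 ≤ p)]

/-- For disjoint `u` and `w`, the map sending `g ∈ L_p([0,1]^{u ∪ w})` to
`∫_{[0,1]^w} g(·_u, y) ∏_{j ∈ w} c (1 - y_j) dy`. -/
def transfer (p : ℝ≥0∞) [Fact (1 ≤ p)] {c : ℂ} (hc : ‖c‖ ≤ 1) (u w : Finset ι) :
    Lp ℂ p (volume : Measure ({j // j ∈ u ∪ w} → unitInterval)) →ₗ[ℂ]
      Lp ℂ p (volume : Measure ({j // j ∈ u} → unitInterval)) :=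
  if h : Disjoint u w then
    (partialIntegralₗ (prodKernel c w) (aestronglyMeasurable_prodKernel c w)
      (norm_prodKernel_le hc w)).comp
      (Lp.compMeasurePreservingₗ ℂ (MeasurableEquiv.piFinsetUnion (fun _ => unitInterval) h)
        (volume_preserving_piFinsetUnion (fun _ => unitInterval) h))
  -- The value `0` for overlapping sets allows sums over all `w`, without a disjointness proof
  -- attached to each term.
  else 0

theorem transfer_of_not_disjoint {c : ℂ} (hc : ‖c‖ ≤ 1) {u w : Finset ι} (h : ¬Disjoint u w) :
    transfer p hc u w = 0 := dif_neg h

/-- Gluing preserves volume, hence is isometric on `L_p`, and the partial integration that follows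
is a contraction. -/
theorem norm_transfer_le {c : ℂ} (hc : ‖c‖ ≤ 1) (u w : Finset ι)
    (g : Lp ℂ p (volume : Measure ({j // j ∈ u ∪ w} → unitInterval))) :
    ‖transfer p hc u w g‖ ≤ ‖g‖ := by
  by_cases h : Disjoint u w
  · rw [transfer, dif_pos h]
    exact (norm_partialIntegralₗ_le (aestronglyMeasurable_prodKernel c w) (norm_prodKernel_le hc w) _).trans_eq (Lp.norm_compMeasurePreserving _ _)
  · rw [transfer_of_not_disjoint hc h, LinearMap.zero_apply, norm_zero]
    exact norm_nonneg g

/-- Fubini for product functions: each variable in `w` integrates to a scalar, and the factors in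
`u` are untouched. -/
theorem transfer_prodLp {c : ℂ} (hc : ‖c‖ ≤ 1) {u w : Finset ι} (h : Disjoint u w)
    {φ : ι → unitInterval → ℂ} (hφ : ∀ j, MemLp (φ j) p volume) :
    transfer p hc u w (prodLp (u ∪ w) hφ) =
      (∏ j ∈ w, ∫ t, c * kernel t * φ j t) • prodLp u hφ := by
  have hmp := volume_preserving_piFinsetUnion (fun _ => unitInterval) h
  have hm := memLp_tensor fun j : {j // j ∈ u ∪ w} => hφ j
  rw [transfer, dif_pos h]
  change partialIntegralₗ _ (aestronglyMeasurable_prodKernel c w) (norm_prodKernel_le hc w)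
    (Lp.compMeasurePreserving _ hmp (hm.toLp _)) = _
  rw [Lp.toLp_compMeasurePreserving hm hmp]
  refine (partialIntegralₗ_toLp _ _ (hm.comp_measurePreserving hmp)).trans ?_
  rw [prodLp, ← MemLp.toLp_const_smul]
  refine MemLp.toLp_congr _ _ (ae_of_all _ fun x => ?_)
  have e : ∀ y : {j // j ∈ w} → unitInterval, prodKernel c w y *
      ∏ j : {j // j ∈ u ∪ w},
        φ j (MeasurableEquiv.piFinsetUnion (fun _ => unitInterval) h (x, y) j) =
      (∏ j : {j // j ∈ w}, c * kernel (y j) * φ j (y j)) * ∏ j : {j // j ∈ u}, φ j (x j) := by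
    intro y
    rw [prod_piFinsetUnion h, prodKernel, mul_left_comm, ← Finset.prod_mul_distrib, mul_comm]
  simp only [Function.comp_apply, e, Pi.smul_apply, smul_eq_mul]
  rw [integral_mul_const,
    integral_fintype_prod_volume_eq_prod fun (j : {j // j ∈ w}) t => c * kernel t * φ j t,
    Finset.prod_coe_sort w fun j => ∫ t, c * kernel t * φ j t]

end Transfer

/-! ### Components of elementary tensors -/

/-- The elementary tensor of univariate functions, as an element of the tensor product. -/
def tensorMk {d : ℕ} {p : ℝ≥0∞} {h : Fin d → unitInterval → ℂ} (hh : ∀ j, IsUnivariate p (h j)) :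
    TensorSpace d p :=
  ⟨tensor h, Submodule.subset_span ⟨h, hh, rfl⟩⟩

theorem tensorSpace_induction {d : ℕ} {p : ℝ≥0∞} {P : TensorSpace d p → Prop}
    (tmk : ∀ (h : Fin d → unitInterval → ℂ) (hh : ∀ j, IsUnivariate p (h j)), P (tensorMk hh))
    (zero : P 0) (add : ∀ f g, P f → P g → P (f + g)) (smul : ∀ (c : ℂ) f, P f → P (c • f))
    (f : TensorSpace d p) : P f := by
  obtain ⟨f, hf⟩ := f
  refine Submodule.span_induction (p := fun f hf => P ⟨f, hf⟩) ?_ zero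
    (fun _ _ _ _ h1 h2 => add _ _ h1 h2) (fun c _ _ h1 => smul c _ h1) hf
  rintro _ ⟨h, hh, rfl⟩
  exact tmk h hh

/-- The formula has the same shape as its ANOVA counterpart: only the scalar functional applied to
the factors outside `u` differs, which lets one argument treat both directions. -/
theorem anchoredLp_tensorMk {d : ℕ} {p : ℝ≥0∞} {h : Fin d → unitInterval → ℂ}
    (hh : ∀ j, IsUnivariate p (h j)) (u : Finset (Fin d)) :
    anchoredLp u (tensorMk hh) = (∏ j ∈ uᶜ, h j 0) • prodLp u fun j => (hh j).memLp_deriv := by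
  rw [anchoredLp, prodLp, ← MemLp.toLp_const_smul]
  refine MemLp.toLp_congr _ _ (ae_of_all _ fun x => ?_)
  change mixedDeriv u (tensor h) _ = (∏ j ∈ uᶜ, h j 0) * _
  rw [mixedDeriv_tensor_glue, mul_comm,
    Finset.prod_subtype uᶜ (fun _ => Finset.mem_compl) fun j => h j 0]
  rfl

theorem anovaLp_tensorMk {d : ℕ} {p : ℝ≥0∞} {h : Fin d → unitInterval → ℂ}
    (hh : ∀ j, IsUnivariate p (h j)) (u : Finset (Fin d)) :
    anovaLp u (tensorMk hh) = (∏ j ∈ uᶜ, ∫ t, h j t) • prodLp u fun j => (hh j).memLp_deriv := by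
  rw [anovaLp, prodLp, ← MemLp.toLp_const_smul]
  refine MemLp.toLp_congr _ _ (ae_of_all _ fun x => ?_)
  change ∫ t, mixedDeriv u (tensor h) _ = (∏ j ∈ uᶜ, ∫ t, h j t) * _
  simp only [mixedDeriv_tensor_glue]
  rw [integral_const_mul, mul_comm,
    integral_fintype_prod_volume_eq_prod fun (j : {j // j ∉ u}) t => h j t,
    Finset.prod_subtype uᶜ (fun _ => Finset.mem_compl) fun j => ∫ t, h j t]

/-! ### Expansion of one kind of component in the other, and the norm estimate -/

section Comparison

variable {d : ℕ} {p : ℝ≥0∞} [Fact (1 ≤ p)]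
  {A B : ∀ u : Finset (Fin d), TensorSpace d p →ₗ[ℂ]
    Lp ℂ p (volume : Measure ({j // j ∈ u} → unitInterval))}
  {a b : (unitInterval → ℂ) → ℂ} {c : ℂ}

/-- Both sides are linear in `f`, so elementary tensors suffice. There it is the expansion of `∏_{j
∉ u} (κ_j + a (h_j))`, where `κ_j` is the kernel integral and `w` is the set of indices at which
`κ_j` is chosen. -/
theorem eq_sum_transfer (hc : ‖c‖ ≤ 1)
    (hA : ∀ (h : Fin d → unitInterval → ℂ) (hh : ∀ j, IsUnivariate p (h j)) (u : Finset (Fin d)),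
      A u (tensorMk hh) = (∏ j ∈ uᶜ, a (h j)) • prodLp u fun j => (hh j).memLp_deriv)
    (hB : ∀ (h : Fin d → unitInterval → ℂ) (hh : ∀ j, IsUnivariate p (h j)) (u : Finset (Fin d)),
      B u (tensorMk hh) = (∏ j ∈ uᶜ, b (h j)) • prodLp u fun j => (hh j).memLp_deriv)
    (hab : ∀ f, IsUnivariate p f → b f = (∫ t, c * kernel t * deriv01 f t) + a f)
    (u : Finset (Fin d)) (f : TensorSpace d p) :
    B u f = ∑ w, transfer p hc u w (A (u ∪ w) f) := by
  induction f using tensorSpace_induction with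
  | tmk h hh =>
    have hsub : ∀ w ∈ uᶜ.powerset, transfer p hc u w (A (u ∪ w) (tensorMk hh)) =
        ((∏ j ∈ w, ∫ t, c * kernel t * deriv01 (h j) t) * ∏ j ∈ uᶜ \ w, a (h j)) •
          prodLp u fun j => (hh j).memLp_deriv := by
      intro w hw
      have hd : Disjoint u w :=
        (disjoint_compl_right (a := u)).mono_right (Finset.mem_powerset.1 hw)
      rw [hA, map_smul, transfer_prodLp hc hd, smul_smul, mul_comm, Finset.compl_union,
        Finset.sdiff_eq_inter_compl]
    rw [hB, Finset.prod_congr rfl fun j _ => hab _ (hh j), Finset.prod_add, Finset.sum_smul,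
      ← Finset.sum_congr rfl hsub]
    -- The expansion only produces `w ⊆ uᶜ`; every other `w` meets `u` and contributes zero.
    refine Finset.sum_subset (Finset.subset_univ _) fun w _ hw => ?_
    rw [transfer_of_not_disjoint hc, LinearMap.zero_apply]
    rw [Finset.mem_powerset] at hw
    exact fun hd => hw (le_compl_iff_disjoint_left.2 hd)
  | zero => simp
  | add f g hf hg => simp only [map_add, hf, hg, Finset.sum_add_distrib]
  | smul r f hf => simp only [map_smul, hf, Finset.smul_sum]

/-- The triangle inequality is applied to the whole tuple, split according to `w`, rather than to
each component. The part belonging to `w` costs only `d^{-|w|}`. -/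
theorem norm_components_le (hd : 1 ≤ d) (hc : ‖c‖ ≤ 1) (f : TensorSpace d p)
    (hAB : ∀ u, B u f = ∑ w, transfer p hc u w (A (u ∪ w) f)) :
    ‖(WithLp.toLp p fun u => ((((d : ℝ) ^ u.card)⁻¹ : ℝ) : ℂ)⁻¹ • B u f : Components d p)‖ ≤
      Real.exp 1 * ‖(WithLp.toLp p fun u => ((((d : ℝ) ^ u.card)⁻¹ : ℝ) : ℂ)⁻¹ • A u f :
        Components d p)‖ := by
  have hd0 : (0 : ℝ) < d := by exact_mod_cast hd
  have hn : ∀ u : Finset (Fin d), ‖((((d : ℝ) ^ u.card)⁻¹ : ℝ) : ℂ)⁻¹‖ = (d : ℝ) ^ u.card := by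
    intro u
    rw [norm_inv, Complex.norm_real, norm_inv, inv_inv, Real.norm_of_nonneg (by positivity)]
  have hsum : (WithLp.toLp p fun u => ((((d : ℝ) ^ u.card)⁻¹ : ℝ) : ℂ)⁻¹ • B u f :
      Components d p) = ∑ w, WithLp.toLp p fun u =>
        ((((d : ℝ) ^ u.card)⁻¹ : ℝ) : ℂ)⁻¹ • transfer p hc u w (A (u ∪ w) f) := by
    ext1 u
    rw [WithLp.ofLp_sum, Finset.sum_apply]
    simp only [hAB, Finset.smul_sum]
  rw [hsum]
  refine (norm_sum_le _ _).trans ?_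
  refine le_trans ?_ (mul_le_mul_of_nonneg_right (sum_inv_pow_card_le_exp d) (norm_nonneg _))
  rw [Finset.sum_mul]
  refine Finset.sum_le_sum fun w _ => ?_
  -- The entrywise constant is `d^{-|w|}`, from `d^{|u|} = d^{-|w|} d^{|u ∪ w|}` for disjoint `u`
  -- and `w`.
  refine norm_piLp_le_of_injOn (by positivity) (Finset.univ.filter fun u => Disjoint u w)
    (σ := fun u => u ∪ w) ?_ (fun u hu => ?_) fun u hu => ?_
  · intro u hu v hv huv
    rw [Finset.coe_filter] at hu hv
    have huv' : u ∪ w = v ∪ w := huv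
    -- A set disjoint from `w` is recovered from its union with `w` by removing `w`.
    rw [← Finset.union_sdiff_cancel_right hu.2, huv', Finset.union_sdiff_cancel_right hv.2]
  · have hdis : Disjoint u w := (Finset.mem_filter.1 hu).2
    rw [norm_smul, norm_smul, hn, hn, Finset.card_union_of_disjoint hdis, pow_add]
    calc (d : ℝ) ^ u.card * ‖transfer p hc u w (A (u ∪ w) f)‖
        ≤ (d : ℝ) ^ u.card * ‖A (u ∪ w) f‖ := by
          gcongr
          exact norm_transfer_le hc u w _
      _ = _ := by field_simp
  · have hdis : ¬Disjoint u w := by simpa using hu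
    rw [PiLp.toLp_apply, transfer_of_not_disjoint hc hdis, LinearMap.zero_apply, smul_zero,
      norm_zero]

end Comparison

/-! ### Norm bounds on the tensor space in both directions -/

/-- `anchoredLp` as a linear map. -/
def anchoredLpₗ (d : ℕ) (p : ℝ≥0∞) (u : Finset (Fin d)) :
    TensorSpace d p →ₗ[ℂ] Lp ℂ p (volume : Measure ({j // j ∈ u} → unitInterval)) where
  toFun := anchoredLp u
  map_add' := anchoredLp_add u
  map_smul' := anchoredLp_smul u

/-- `anovaLp` as a linear map. -/
def anovaLpₗ (d : ℕ) (p : ℝ≥0∞) (u : Finset (Fin d)) :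
    TensorSpace d p →ₗ[ℂ] Lp ℂ p (volume : Measure ({j // j ∈ u} → unitInterval)) where
  toFun := anovaLp u
  map_add' := anovaLp_add u
  map_smul' := anovaLp_smul u

section Norms

variable {d : ℕ} {p : ℝ≥0∞} [hp : Fact (1 ≤ p)]

theorem norm_toAnova_le (hd : 1 ≤ d) (f : TensorSpace d p) :
    ‖toAnova p (fun u : Finset (Fin d) => ((d : ℝ) ^ u.card)⁻¹) f‖ ≤
      Real.exp 1 * ‖toAnchored p (fun u : Finset (Fin d) => ((d : ℝ) ^ u.card)⁻¹) f‖ := by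
  refine (UniformSpace.Completion.norm_coe _).trans_le <| le_trans ?_ <|
    mul_le_mul_of_nonneg_left (UniformSpace.Completion.norm_coe _).ge (Real.exp_nonneg 1)
  refine norm_components_le (A := anchoredLpₗ d p) (B := anovaLpₗ d p) (c := 1) hd norm_one.le f
    fun u => eq_sum_transfer (a := fun h => h 0) (b := fun h => ∫ t, h t) _
      (fun _ hh => anchoredLp_tensorMk hh) (fun _ hh => anovaLp_tensorMk hh) (fun h hh => ?_) u f
  simp only [one_mul]
  rw [hh.integral_eq hp.out, add_comm]

theorem norm_toAnchored_le (hd : 1 ≤ d) (f : TensorSpace d p) :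
    ‖toAnchored p (fun u : Finset (Fin d) => ((d : ℝ) ^ u.card)⁻¹) f‖ ≤
      Real.exp 1 * ‖toAnova p (fun u : Finset (Fin d) => ((d : ℝ) ^ u.card)⁻¹) f‖ := by
  refine (UniformSpace.Completion.norm_coe _).trans_le <| le_trans ?_ <|
    mul_le_mul_of_nonneg_left (UniformSpace.Completion.norm_coe _).ge (Real.exp_nonneg 1)
  -- Solving the univariate identity for `h 0` changes the sign of the kernel, hence `c = -1`.
  refine norm_components_le (A := anovaLpₗ d p) (B := anchoredLpₗ d p) (c := -1) hd
    (by simp) f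
    fun u => eq_sum_transfer (a := fun h => ∫ t, h t) (b := fun h => h 0) _
      (fun _ hh => anovaLp_tensorMk hh) (fun _ hh => anchoredLp_tensorMk hh) (fun h hh => ?_) u f
  simp only [neg_mul, one_mul, integral_neg]
  rw [hh.integral_eq hp.out]
  ring

end Norms

/-! ### Passage to the completions -/

/-- The canonical map into the anchored space, as a linear map. -/
def toAnchoredₗ {d : ℕ} (p : ℝ≥0∞) [Fact (1 ≤ p)] (γ : Finset (Fin d) → ℝ) :
    TensorSpace d p →ₗ[ℂ] AnchoredSpace p γ where
  toFun := toAnchored p γ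
  map_add' f g := UniformSpace.Completion.coe_add (α := AnchoredTensor p γ) f g
  map_smul' c f := UniformSpace.Completion.coe_smul (X := AnchoredTensor p γ) c f

/-- The canonical map into the ANOVA space, as a linear map. -/
def toAnovaₗ {d : ℕ} (p : ℝ≥0∞) [Fact (1 ≤ p)] (γ : Finset (Fin d) → ℝ) :
    TensorSpace d p →ₗ[ℂ] AnovaSpace p γ where
  toFun := toAnova p γ
  map_add' f g := UniformSpace.Completion.coe_add (α := AnovaTensor p γ) f g
  map_smul' c f := UniformSpace.Completion.coe_smul (X := AnovaTensor p γ) c f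

theorem denseRange_toAnchoredₗ {d : ℕ} (p : ℝ≥0∞) [Fact (1 ≤ p)] (γ : Finset (Fin d) → ℝ) :
    DenseRange (toAnchoredₗ p γ) :=
  UniformSpace.Completion.denseRange_coe (α := AnchoredTensor p γ)

theorem denseRange_toAnovaₗ {d : ℕ} (p : ℝ≥0∞) [Fact (1 ≤ p)] (γ : Finset (Fin d) → ℝ) :
    DenseRange (toAnovaₗ p γ) :=
  UniformSpace.Completion.denseRange_coe (α := AnovaTensor p γ)

end MixedSmoothness
end

open MixedSmoothness in
theorem corollary6 (p : ENNReal) [Fact (1 ≤ p)] :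
    MixedSmoothness.UniformlyEquivalent p
      (fun (d : ℕ) (u : Finset (Fin d)) => ((d : ℝ) ^ u.card)⁻¹) := by
  refine ⟨Real.exp 1, Real.exp_pos 1, fun d hd => ?_⟩
  let γ : Finset (Fin d) → ℝ := fun u => ((d : ℝ) ^ u.card)⁻¹
  have h1 := denseRange_toAnchoredₗ p γ
  have h2 := denseRange_toAnovaₗ p γ
  have n1 : ∀ f, ‖toAnovaₗ p γ (LinearEquiv.refl ℂ (TensorSpace d p) f)‖ ≤
      Real.exp 1 * ‖toAnchoredₗ p γ f‖ := norm_toAnova_le hd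
  have n2 : ∀ f, ‖toAnchoredₗ p γ ((LinearEquiv.refl ℂ (TensorSpace d p)).symm f)‖ ≤
      Real.exp 1 * ‖toAnovaₗ p γ f‖ := norm_toAnchored_le hd
  -- The identity is bounded by `e` in both directions and the tensor space is dense in both
  -- completions, so it extends to mutually inverse maps with the same bounds.
  refine ⟨(LinearEquiv.refl ℂ (TensorSpace d p)).extend (toAnchoredₗ p γ) (toAnovaₗ p γ)
    h1 ⟨_, n1⟩ h2 ⟨_, n2⟩, fun f => ?_, ?_, ?_⟩
  · exact LinearEquiv.extend_eq _ _ _ h1 ⟨_, n1⟩ h2 ⟨_, n2⟩ f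
  · exact LinearMap.opNorm_extendOfNorm_le h1 (Real.exp_nonneg 1) n1
  · exact LinearMap.opNorm_extendOfNorm_le h2 (Real.exp_nonneg 1) n2
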